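/- Let $V$ be a finite set (e.g. $V=[n]$) and let $\Delta$ be a simplicial complex on $V$, i.e. a family of subsets of $V$ closed under taking subsets (elements of $V$ need not all be vertices of $\Delta$). A decomposition of $\Delta$ is a triple $(\Delta_1,S,\Delta_2)$ with $S\subseteq V$ and $\Delta_1,\Delta_2$ induced subcomplexes of $\Delta$ (each consisting of all faces of $\Delta$ contained in some subset of $V$) such that $\Delta_1\cup\Delta_2=\Delta$ and $\Delta_1\cap\Delta_2=2^S$. The class of decomposable complexes is defined recursively: $\Delta$ is decomposable if it has a decomposition $(\Delta_1,S,\Delta_2)$ in which each of $\Delta_1,\Delta_2$ is decomposable or a simplex $2^T$ (so a simplex is decomposable). Let $d=(d_v)_{v\in V}$ be a vector of positive integers. Let $A_\Delta$ be the $0/1$ matrix with columns indexed by $t\in\prod_{v\in V}[d_v]$ and rows indexed by the pairs $(S,c)$, where $S$ is a facet (inclusion-maximal face) of $\Delta$ and $c\in\prod_{v\in S}[d_v]$, whose entry at $((S,c),t)$ is $1$ if $t|_S=c$ and $0$ otherwise; thus $A_\Delta$ maps a $\prod_v d_v$ table to its margins along the facets of $\Delta$. Let $P_\Delta$ be the convex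 hull of the columns of $A_\Delta$ and $\mathcal L$ the smallest lattice containing these columns (the subgroup they generate). For a lattice polytope $P$ and an ordering $p_1,\dots,p_k$ of its lattice points, the pulling triangulation of $P$ is defined recursively: if $p_1,\dots,p_k$ are affinely independent, its only simplex is $\{p_1,\dots,p_k\}$; otherwise its simplices are the sets $\{p_1\}\cup\sigma$, where $F$ runs over the facets of $P$ not containing $p_1$ and $\sigma$ over the simplices of the pulling triangulation of $F$ for the induced ordering of the lattice points in $F$. The lattice polytope $P$ is compressed if, for every ordering of its lattice points, every simplex of the pulling triangulation is a $\dim P$-dimensional simplex attaining the minimal ($\dim P$-dimensional Euclidean) volume among all $\dim P$-dimensional simplices whose vertices are lattice points of $P$. If $\Delta$ is decomposable, then for every vector $d$ of positive integers the marginal polytope $P_\Delta$ is compressed with respect to $\mathcal L$. -/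

import Mathlib

open MeasureTheory

/-! ### Lattice polytopes, pulling triangulations, compressed polytopes -/

section Polytopes

variable {E : Type*} [NormedAddCommGroup E] [InnerProductSpace ℝ E]

/-- The dimension of a nonempty convex set: the dimension of its affine span. -/
noncomputable def polytopeDim (P : Set E) : ℕ :=
  Module.finrank ℝ (vectorSpan ℝ P)

/-- `F` is a facet of the polytope `P`: a nonempty face (the set of maximizers over `P` of a linear
functional) whose dimension is one less than that of `P`. -/
structure IsPolytopeFacet (P F : Set E) : Prop where
  nonempty : F.Nonempty
  exposed : IsExposed ℝ P F
  dim : polytopeDim F + 1 = polytopeDim P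

open Classical in
/-- `IsPullingSimplex P l σ`: `σ` is (the vertex set of) one of the simplices of the pulling
triangulation of `P` induced by the ordered list `l` of the lattice points of `P`.
If `l` is affinely independent, its point set is the only simplex. Otherwise the simplices are the
sets `{p} ∪ σ`, where `p` is the first point of the list, `F` is a facet of `P` that does not
contain `p`, and `σ` is a simplex of the pulling triangulation of `F` induced by the sublist of
the points lying in `F`. -/
inductive IsPullingSimplex : Set E → List E → Set E → Prop
  | base (P : Set E) (l : List E)
      (hl : AffineIndependent ℝ (Subtype.val : {x // x ∈ l} → E)) :
      IsPullingSimplex P l {x | x ∈ l}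
  | cone (P : Set E) (p : E) (l : List E) (F σ : Set E)
      (hl : ¬ AffineIndependent ℝ (Subtype.val : {x // x ∈ p :: l} → E))
      (hF : IsPolytopeFacet P F) (hp : p ∉ F)
      (hσ : IsPullingSimplex F ((p :: l).filter (fun x => x ∈ F)) σ) :
      IsPullingSimplex P (p :: l) (insert p σ)

/-- The pulling triangulation of `P` induced by the ordered list `l` of its lattice points, as the
set of (vertex sets of) its maximal simplices. -/
def pullingTriangulation (P : Set E) (l : List E) : Set (Set E) :=
  {σ | IsPullingSimplex P l σ}

/-- The points of the lattice `L` that lie in `P`. -/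
def latticePoints (L : AddSubgroup E) (P : Set E) : Set E :=
  {x | x ∈ L ∧ x ∈ P}

/-- `P` is a lattice polytope with respect to `L`: the convex hull of its lattice points, of which
there are finitely many. -/
structure IsLatticePolytope (L : AddSubgroup E) (P : Set E) : Prop where
  finite : (latticePoints L P).Finite
  convexHull_eq : convexHull ℝ (latticePoints L P) = P

/-- `σ` is the vertex set of a full-dimensional simplex formed by lattice points of `P`. -/
structure IsLatticeSimplex (L : AddSubgroup E) (P : Set E) (σ : Set E) : Prop where
  subset : σ ⊆ latticePoints L P
  affineIndependent : AffineIndependent ℝ (Subtype.val : σ → E)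
  card : σ.ncard = polytopeDim P + 1

variable [MeasurableSpace E] [BorelSpace E]

/-- The Euclidean `k`-dimensional volume of the convex hull of `σ`, where `k = dim P`. -/
noncomputable def simplexVolume (P σ : Set E) : ENNReal :=
  μHE[polytopeDim P] (convexHull ℝ σ)

/-- A triangulation `T` of the lattice polytope `P` is unimodular if every simplex in it attains
the minimal volume among all (full-dimensional) simplices formed by lattice points of `P`. -/
def IsUnimodularTriangulation (L : AddSubgroup E) (P : Set E) (T : Set (Set E)) : Prop :=
  ∀ σ ∈ T, IsLatticeSimplex L P σ ∧
    ∀ τ : Set E, IsLatticeSimplex L P τ → simplexVolume P σ ≤ simplexVolume P τ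

/-- A lattice polytope `P` is compressed with respect to `L` if, for every ordering of its lattice
points, the induced pulling triangulation is unimodular. -/
structure IsCompressed (L : AddSubgroup E) (P : Set E) : Prop where
  isLatticePolytope : IsLatticePolytope L P
  unimodular : ∀ l : List E, l.Nodup → (∀ x, x ∈ l ↔ x ∈ latticePoints L P) →
    IsUnimodularTriangulation L P (pullingTriangulation P l)

end Polytopes

/-! ### The polytope of an integral matrix -/

section Matrices

variable {ι κ : Type*} [Fintype ι]

/-- The `j`-th column of an integral matrix, as a point of Euclidean space. -/
def columnPoint (A : Matrix ι κ ℤ) (j : κ) : EuclideanSpace ℝ ι :=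
  WithLp.toLp 2 (fun i => (A i j : ℝ))

/-- The convex hull `P_A` of the columns of `A`. -/
def columnPolytope (A : Matrix ι κ ℤ) : Set (EuclideanSpace ℝ ι) :=
  convexHull ℝ (Set.range (columnPoint A))

/-- The smallest lattice containing the columns of `A`. -/
def columnLattice (A : Matrix ι κ ℤ) : AddSubgroup (EuclideanSpace ℝ ι) :=
  AddSubgroup.closure (Set.range (columnPoint A))

end Matrices

/-! ### Simplicial complexes and marginal polytopes -/

section Complexes

variable {V : Type*}

/-- Families of subsets of `V` closed under passing to subsets. The complex `2^S` of all subsets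
of `S` is `LowerSet.Iic S`; unions and intersections of complexes are `⊔` and `⊓`. -/
abbrev SubsetComplex (V : Type*) := LowerSet (Finset V)

/-- `Δ'` is an induced subcomplex of `Δ`: it consists of all faces of `Δ` inside some vertex
set `W`. -/
def SubsetComplex.IsInduced (Δ' Δ : SubsetComplex V) : Prop :=
  ∃ W : Finset V, ∀ s : Finset V, s ∈ Δ' ↔ s ∈ Δ ∧ s ⊆ W

/-- `Δ` is reducible with decomposition `(Δ₁, S, Δ₂)`. -/
structure SubsetComplex.IsDecomposition (Δ Δ₁ : SubsetComplex V) (S : Finset V)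
    (Δ₂ : SubsetComplex V) : Prop where
  induced_left : Δ₁.IsInduced Δ
  induced_right : Δ₂.IsInduced Δ
  union_eq : Δ₁ ⊔ Δ₂ = Δ
  inter_eq : Δ₁ ⊓ Δ₂ = LowerSet.Iic S

/-- Decomposable complexes: those obtained from simplices by finitely many decompositions.
A simplex `2^S` has the decomposition `(2^S, S, 2^S)`, so it is itself decomposable; see
`SubsetComplex.isDecomposable_iff`. -/
inductive SubsetComplex.IsDecomposable : SubsetComplex V → Prop
  | simplex (S : Finset V) : IsDecomposable (LowerSet.Iic S)
  | glue (Δ Δ₁ : SubsetComplex V) (S : Finset V) (Δ₂ : SubsetComplex V)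
      (h : Δ.IsDecomposition Δ₁ S Δ₂) (h₁ : IsDecomposable Δ₁) (h₂ : IsDecomposable Δ₂) :
      IsDecomposable Δ

/-- A complex is decomposable if and only if it is reducible and each of the two parts is either
decomposable or a simplex. -/
theorem SubsetComplex.isDecomposable_iff (Δ : SubsetComplex V) :
    Δ.IsDecomposable ↔ ∃ (Δ₁ : SubsetComplex V) (S : Finset V) (Δ₂ : SubsetComplex V),
      Δ.IsDecomposition Δ₁ S Δ₂ ∧
      (Δ₁.IsDecomposable ∨ ∃ T : Finset V, Δ₁ = LowerSet.Iic T) ∧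
      (Δ₂.IsDecomposable ∨ ∃ T : Finset V, Δ₂ = LowerSet.Iic T) := by
  constructor
  · intro h
    cases h with
    | simplex S =>
      exact ⟨LowerSet.Iic S, S, LowerSet.Iic S,
        ⟨⟨S, fun s => by simp⟩, ⟨S, fun s => by simp⟩, sup_idem _, inf_idem _⟩,
        Or.inr ⟨S, rfl⟩, Or.inr ⟨S, rfl⟩⟩
    | glue _ Δ₁ S Δ₂ h h₁ h₂ => exact ⟨Δ₁, S, Δ₂, h, Or.inl h₁, Or.inl h₂⟩
  · rintro ⟨Δ₁, S, Δ₂, h, h₁, h₂⟩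
    refine .glue Δ Δ₁ S Δ₂ h ?_ ?_
    · rcases h₁ with h₁ | ⟨T, rfl⟩
      · exact h₁
      · exact .simplex T
    · rcases h₂ with h₂ | ⟨T, rfl⟩
      · exact h₂
      · exact .simplex T

variable [Fintype V] [DecidableEq V]

open Classical in
/-- The facets (inclusion-maximal faces) of a complex. -/
noncomputable def SubsetComplex.facets (Δ : SubsetComplex V) : Finset (Finset V) :=
  Finset.univ.filter (fun S => Maximal (fun T => T ∈ Δ) S)

/-- The entries of all released margins: a facet `S` together with a cell of the `S`-margin of a
table with `d v` levels in direction `v`. -/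
abbrev MarginCell (Δ : SubsetComplex V) (d : V → ℕ) : Type _ :=
  Σ S : {S : Finset V // S ∈ Δ.facets}, ((v : {v : V // v ∈ S.1}) → Fin (d v.1))

/-- The matrix `A_Δ` of the linear map sending a table to its margins along the facets of `Δ`: the
entry at the margin cell `(S, c)` and the table cell `t` is `1` if `t` restricts to `c` on `S` and
`0` otherwise. -/
def marginalMatrix (Δ : SubsetComplex V) (d : V → ℕ) :
    Matrix (MarginCell Δ d) ((v : V) → Fin (d v)) ℤ :=
  fun r t => if (fun v : {v : V // v ∈ r.1.1} => t v.1) = r.2 then 1 else 0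

end Complexes

/-! Decomposability enters only through nonnegativity: if a real table has nonnegative margins on
every face, some nonnegative table has the same margins
(`SubsetComplex.IsDecomposable.exists_nonneg_table`). For a simplex, the top margin is spread
uniformly over its fibers. For a decomposition along `S`, the two tables are glued by the
conditional-independence product, the product of their margins divided by the `S`-margin. Hence
`P_Δ` is the height-one section of its linear span by the nonnegative orthant (`IsOrthantSection`),
and its vertices are `0/1` vectors.

Such polytopes have facet width one. A facet `F` lies in some `x i = 0`, and this equation cuts the
span of `F` out of the span of the polytope (`IsOrthantSection.exists_coordinate`), so a lattice
point `p` outside `F` has `p i = 1`. For an integral `y` in the span, `y - y i • p` lies in the span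
of `F`. By induction along the pulling construction, every simplex generates all integral vectors of
the span (`IsPullingSimplex.generates`). The base case reads the coefficients off dual coordinates
(`IsOrthantSection.exists_dual_coordinate`).

The edge vectors of any other lattice simplex are then integral combinations of those of a pulling
simplex, and the transition determinant is a nonzero integer, so the volume cannot be smaller
(`simplexVolume_le`). -/

/-! ### Volumes of simplices with integrally related edges. -/

section Volume

variable {E : Type*} [NormedAddCommGroup E] [InnerProductSpace ℝ E]

/-- The simplex with apex `p` and edge vectors `c i ∈ W` is a translate of a simplex in `W`. -/
theorem convexHull_insert_range_add {κ : Type*} (W : Submodule ℝ E) (p : E) (c : κ → W) :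
    convexHull ℝ (insert p (Set.range fun i => p + (c i : E))) =
      (fun x : W => p + (x : E)) '' convexHull ℝ (insert 0 (Set.range c)) := by
  let g : W →ᵃ[ℝ] E := AffineMap.const ℝ W p + W.subtype.toAffineMap
  have hg : (fun x : W => p + (x : E)) = g := by
    ext x; simp [g]
  rw [hg, AffineMap.image_convexHull, Set.image_insert_eq, ← Set.range_comp, ← hg]
  simp [Function.comp_def]

variable [MeasurableSpace E] [BorelSpace E]

theorem euclideanHausdorffMeasure_convexHull_insert_range_add {κ : Type*} (k : ℕ)
    (W : Submodule ℝ E) (p : E) (c : κ → W) :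
    μHE[k] (convexHull ℝ (insert p (Set.range fun i => p + (c i : E)))) =
      μHE[k] (convexHull ℝ (insert 0 (Set.range c))) := by
  rw [convexHull_insert_range_add]
  refine Isometry.euclideanHausdorffMeasure_image (f := fun x : W => p + (x : E)) ?_ _
  exact (IsometryEquiv.addLeft p).isometry.comp isometry_subtype_coe

/-- A simplex whose edge vectors are integral combinations of the edge vectors of a second simplex
has at least the volume of the second one. -/
theorem euclideanHausdorffMeasure_simplex_le {κ : Type*} [Fintype κ] [DecidableEq κ]
    (W : Submodule ℝ E) [FiniteDimensional ℝ W] (b : Module.Basis κ ℝ W) (c : κ → W)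
    (hc : LinearIndependent ℝ c) (hint : ∀ i j, ∃ n : ℤ, b.repr (c j) i = n) (p q : E) :
    μHE[Module.finrank ℝ W] (convexHull ℝ (insert p (Set.range fun i => p + (b i : E)))) ≤
      μHE[Module.finrank ℝ W] (convexHull ℝ (insert q (Set.range fun i => q + (c i : E)))) := by
  rw [euclideanHausdorffMeasure_convexHull_insert_range_add,
    euclideanHausdorffMeasure_convexHull_insert_range_add _ W q c]
  -- The second simplex is the image of the first under `f`, whose matrix in the basis `b` is
  -- integral; volume scales by the absolute value of a nonzero integer.
  let f : W →ₗ[ℝ] W := b.constr ℝ c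
  have hfb : ∀ i, f (b i) = c i := fun i => b.constr_basis ℝ c i
  have himage : convexHull ℝ (insert 0 (Set.range c)) =
      f '' convexHull ℝ (insert 0 (Set.range b)) := by
    rw [LinearMap.image_convexHull, Set.image_insert_eq, ← Set.range_comp, map_zero]
    congr 3
    ext i
    simp [hfb]
  choose n hn using hint
  have hmat : LinearMap.toMatrix b b f = (Matrix.of n).map (Int.castRingHom ℝ) := by
    ext i j
    simp [LinearMap.toMatrix_apply, hfb, hn]
  have hdet : LinearMap.det f = ((Matrix.of n).det : ℝ) := by
    rw [← LinearMap.det_toMatrix b, hmat, ← RingHom.mapMatrix_apply, ← RingHom.map_det]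
    simp
  have hinj : Function.Injective f := by
    rw [← LinearMap.ker_eq_bot, LinearMap.ker_eq_bot']
    intro x hx
    have hx' : f (∑ i, b.repr x i • b i) = 0 := by rw [b.sum_repr, hx]
    rw [map_sum] at hx'
    simp only [map_smul, hfb] at hx'
    have h0 := Fintype.linearIndependent_iff.1 hc _ hx'
    rw [← b.sum_repr x]
    simp [h0]
  have hne : LinearMap.det f ≠ 0 := by
    rw [← isUnit_iff_ne_zero, ← LinearMap.isUnit_iff_isUnit_det, Module.End.isUnit_iff]
    exact ⟨hinj, LinearMap.injective_iff_surjective.1 hinj⟩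
  have hge : (1 : ℝ) ≤ |LinearMap.det f| := by
    rw [hdet] at hne ⊢
    have : (Matrix.of n).det ≠ 0 := by exact_mod_cast hne
    exact_mod_cast Int.one_le_abs this
  rw [himage, Measure.addHaar_image_linearMap]
  calc _ = 1 * μHE[Module.finrank ℝ W] (convexHull ℝ (insert 0 (Set.range b))) := (one_mul _).symm
    _ ≤ _ := by
      gcongr
      exact ENNReal.one_le_ofReal.2 hge

end Volume

/-! ### Sections of the nonnegative orthant: faces, facets and simplices. -/

section OrthantSections

/-- A family of points at height one is linearly independent as soon as it is affinely
independent. -/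
theorem AffineIndependent.linearIndependent_of_map_eq_one {κ E : Type*} [AddCommGroup E]
    [Module ℝ E] {p : κ → E} (hp : AffineIndependent ℝ p) (h : E →ₗ[ℝ] ℝ)
    (hh : ∀ i, h (p i) = 1) : LinearIndependent ℝ p := by
  rw [linearIndependent_iff']
  intro s g hg
  refine affineIndependent_iff.1 hp s g ?_ hg
  have := congrArg h hg
  simpa [map_sum, hh] using this

/-- The functional `h` kills the direction space but not a point `q` of `Q`, so the span splits as
the direction space plus the line through `q`. This trades polytope dimensions for ranks. -/
theorem finrank_span_eq_finrank_vectorSpan_add_one {E : Type*} [AddCommGroup E]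
    [Module ℝ E] [FiniteDimensional ℝ E] {Q : Set E} (hne : Q.Nonempty) (h : E →ₗ[ℝ] ℝ)
    (hh : ∀ x ∈ Q, h x = 1) :
    Module.finrank ℝ (Submodule.span ℝ Q) = Module.finrank ℝ (vectorSpan ℝ Q) + 1 := by
  obtain ⟨q, hq⟩ := hne
  have hker : vectorSpan ℝ Q ≤ LinearMap.ker h := by
    rw [vectorSpan_def, Submodule.span_le]
    rintro _ ⟨x, hx, y, hy, rfl⟩
    simp [hh x hx, hh y hy]
  have hsup : vectorSpan ℝ Q ⊔ Submodule.span ℝ {q} = Submodule.span ℝ Q := by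
    apply le_antisymm
    · refine sup_le ?_ (Submodule.span_mono (Set.singleton_subset_iff.2 hq))
      rw [vectorSpan_def, Submodule.span_le]
      rintro _ ⟨x, hx, y, hy, rfl⟩
      exact sub_mem (Submodule.subset_span hx) (Submodule.subset_span hy)
    · rw [Submodule.span_le]
      intro x hx
      rw [← sub_add_cancel x q]
      exact Submodule.add_mem_sup (vsub_mem_vectorSpan ℝ hx hq)
        (Submodule.mem_span_singleton_self q)
  have hinf : vectorSpan ℝ Q ⊓ Submodule.span ℝ {q} = ⊥ := by
    rw [eq_bot_iff]
    rintro x ⟨hx, hxq⟩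
    obtain ⟨c, rfl⟩ := Submodule.mem_span_singleton.1 hxq
    have := hker hx
    simp only [LinearMap.mem_ker, map_smul, hh q hq, smul_eq_mul, mul_one] at this
    simp [this]
  have hq0 : q ≠ 0 := by
    rintro rfl
    simpa using hh 0 hq
  have := Submodule.finrank_sup_add_finrank_inf_eq (vectorSpan ℝ Q) (Submodule.span ℝ {q})
  rwa [hsup, hinf, finrank_bot, finrank_span_singleton hq0, add_zero] at this

/-- An exposed face of the convex hull of a finite set is the convex hull of the points of that set
it contains. -/
theorem IsExposed.convexHull_inter_eq {E : Type*} [NormedAddCommGroup E] [NormedSpace ℝ E]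
    {s F : Set E} (hs : s.Finite) (hF : IsExposed ℝ (convexHull ℝ s) F) :
    convexHull ℝ (s ∩ F) = F := by
  have hconv : Convex ℝ F := hF.convex (convex_convexHull ℝ s)
  apply subset_antisymm (convexHull_min Set.inter_subset_right hconv)
  -- Extreme points of a face are extreme in the whole hull, hence lie in `s`; Krein–Milman does the
  -- rest.
  have hext : F.extremePoints ℝ ⊆ s ∩ F := fun x hx =>
    ⟨extremePoints_convexHull_subset (hF.isExtreme.extremePoints_subset_extremePoints hx), hx.1⟩
  have hcpt := hF.isCompact (hs.isCompact_convexHull ℝ)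
  exact (closure_convexHull_extremePoints hcpt hconv).symm.le.trans
    (closure_minimal (convexHull_mono hext) ((hs.inter_of_left F).isClosed_convexHull ℝ))

variable {ι : Type*}

/-- `Q` is the section at height one of the nonnegative orthant by the linear span of `Q`. -/
structure IsOrthantSection (h : EuclideanSpace ℝ ι →ₗ[ℝ] ℝ) (Q : Set (EuclideanSpace ℝ ι)) :
    Prop where
  nonneg : ∀ x ∈ Q, ∀ i, 0 ≤ x i
  height : ∀ x ∈ Q, h x = 1
  mem : ∀ y ∈ Submodule.span ℝ Q, (∀ i, 0 ≤ y i) → h y = 1 → y ∈ Q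

variable {h : EuclideanSpace ℝ ι →ₗ[ℝ] ℝ} {Q F : Set (EuclideanSpace ℝ ι)}

/-- If `l` exposes `F` with maximum `l f`, then `l - l f • h` vanishes on the span of `F`, so every
height-one point of that span attains the maximum. -/
theorem IsOrthantSection.of_isExposed (hQ : IsOrthantSection h Q) (hF : IsExposed ℝ Q F)
    (hne : F.Nonempty) : IsOrthantSection h F := by
  have hsub := hF.subset
  refine ⟨fun x hx => hQ.nonneg x (hsub hx), fun x hx => hQ.height x (hsub hx), ?_⟩
  intro y hy hy0 hy1
  have hyQ := hQ.mem y (Submodule.span_mono hsub hy) hy0 hy1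
  obtain ⟨l, hl⟩ := hF hne
  obtain ⟨f, hf⟩ := hne
  have hker : Submodule.span ℝ F ≤ LinearMap.ker (l.toLinearMap - l f • h) := by
    rw [Submodule.span_le]
    intro x hx
    have h1 : l x = l f := by
      rw [hl] at hx hf
      exact le_antisymm (hf.2 x hx.1) (hx.2 f hf.1)
    simp [h1, hQ.height x (hsub hx)]
  have hly : l y = l f := by
    have := hker hy
    simpa [hy1, sub_eq_zero] using this
  rw [hl] at hf ⊢
  exact ⟨hyQ, fun z hz => by rw [hly]; exact hf.2 z hz⟩

variable [Fintype ι]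

/-- A nonempty convex set of nonnegative vectors has a point of maximal support. -/
theorem exists_mem_maximal_support (hF : Convex ℝ F) (hne : F.Nonempty)
    (h0 : ∀ x ∈ F, ∀ i, 0 ≤ x i) : ∃ z ∈ F, ∀ i, z i = 0 → ∀ x ∈ F, x i = 0 := by
  classical
  obtain ⟨f, hf⟩ := hne
  have hx : ∀ i, ∃ x ∈ F, x i = 0 → ∀ x ∈ F, x i = 0 := by
    intro i
    by_cases hi : ∀ x ∈ F, x i = 0
    · exact ⟨f, hf, fun _ => hi⟩
    · push Not at hi
      obtain ⟨x, hx, hxi⟩ := hi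
      exact ⟨x, hx, fun h => absurd h hxi⟩
  choose x hxF hx using hx
  -- The uniform average of these points has maximal support; the extra index `none` keeps the
  -- family nonempty when `ι` is empty.
  let p : Option ι → EuclideanSpace ℝ ι := fun o => o.elim f x
  have hp : ∀ o, p o ∈ F := by
    rintro (_ | i)
    exacts [hf, hxF i]
  let c : ℝ := (Fintype.card (Option ι) : ℝ)⁻¹
  have hc : 0 < c := by
    have : (0 : ℝ) < Fintype.card (Option ι) := by exact_mod_cast Fintype.card_pos
    exact inv_pos.2 this
  refine ⟨∑ o, c • p o, hF.sum_mem (fun _ _ => hc.le) ?_ fun o _ => hp o, ?_⟩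
  · have : (Fintype.card (Option ι) : ℝ) ≠ 0 := by exact_mod_cast Fintype.card_ne_zero
    rw [Finset.sum_const, nsmul_eq_mul]
    exact mul_inv_cancel₀ this
  · intro i hi
    apply hx i
    have hi' : ∑ o, c * p o i = 0 := by
      simpa [WithLp.ofLp_sum, Finset.sum_apply] using hi
    have := (Finset.sum_eq_zero_iff_of_nonneg
      (fun o _ => mul_nonneg hc.le (h0 _ (hp o) i))).1 hi' (some i) (Finset.mem_univ _)
    simpa [hc.ne', p] using this

/-- Each facet of an orthant section is cut out by the vanishing of a coordinate. -/
theorem IsOrthantSection.exists_coordinate (hQ : IsOrthantSection h Q) (hconv : Convex ℝ Q)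
    (hF : IsPolytopeFacet Q F) :
    ∃ i, (∀ x ∈ F, x i = 0) ∧ ∀ y ∈ Submodule.span ℝ Q, y i = 0 → y ∈ Submodule.span ℝ F := by
  have hsub := hF.exposed.subset
  have hQne := hF.nonempty.mono hsub
  obtain ⟨z, hz, hzmax⟩ := exists_mem_maximal_support (hF.exposed.convex hconv) hF.nonempty
    fun x hx => hQ.nonneg x (hsub hx)
  have hdimF := finrank_span_eq_finrank_vectorSpan_add_one hF.nonempty h
    fun x hx => hQ.height x (hsub hx)
  have hdimQ := finrank_span_eq_finrank_vectorSpan_add_one hQne h hQ.height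
  have hdim := hF.dim
  unfold polytopeDim at hdim
  -- Otherwise `z` could be pushed slightly away from any `q ∈ Q` without leaving `Q`. As `l` is
  -- maximal at `z`, this forces `l z ≤ l q`, hence `F = Q`, against the dimensions.
  have hex : ∃ i, z i = 0 ∧ ∃ q ∈ Q, q i ≠ 0 := by
    by_contra! hcon
    obtain ⟨l, hl⟩ := hF.exposed hF.nonempty
    have hFQ : Q ⊆ F := by
      intro q hq
      have hev : ∀ᶠ ε : ℝ in nhdsWithin 0 (Set.Ioi 0), ∀ i, 0 ≤ (z - ε • (q - z)) i := by
        rw [Filter.eventually_all]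
        intro i
        rcases (hQ.nonneg z (hsub hz) i).eq_or_lt with hi | hi
        · have hqi := hcon i hi.symm q hq
          exact Filter.Eventually.of_forall fun ε => by simp [← hi, hqi]
        · have hcont : Continuous fun ε : ℝ => (z - ε • (q - z)) i := by
            simp only [PiLp.sub_apply, PiLp.smul_apply, smul_eq_mul]
            fun_prop
          have : Filter.Tendsto (fun ε : ℝ => (z - ε • (q - z)) i) (nhdsWithin 0 (Set.Ioi 0))
              (nhds (z i)) := by
            have := (hcont.tendsto 0).mono_left
              (nhdsWithin_le_nhds (s := Set.Ioi (0 : ℝ)))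
            simpa using this
          exact (this.eventually (lt_mem_nhds hi)).mono fun _ => le_of_lt
      obtain ⟨ε, hε0, hε⟩ := (hev.and self_mem_nhdsWithin).exists
      have hmem : z - ε • (q - z) ∈ Q := by
        have hzs := Submodule.subset_span (R := ℝ) (hsub hz)
        refine hQ.mem _ (sub_mem hzs (Submodule.smul_mem _ _
          (sub_mem (Submodule.subset_span hq) hzs))) hε0 ?_
        simp [hQ.height z (hsub hz), hQ.height q hq]
      rw [hl] at hz ⊢
      have h1 := hz.2 _ hmem
      simp only [map_sub, map_smul, smul_eq_mul] at h1
      have h2 : l z ≤ l q := by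
        have : 0 ≤ ε * (l q - l z) := by linarith
        have := nonneg_of_mul_nonneg_right this hε
        linarith
      exact ⟨hq, fun y hy => (hz.2 y hy).trans h2⟩
    rw [subset_antisymm hsub hFQ] at hdim
    omega
  obtain ⟨i, hzi, q, hq, hqi⟩ := hex
  refine ⟨i, hzmax i hzi, ?_⟩
  let π : EuclideanSpace ℝ ι →ₗ[ℝ] ℝ :=
    (EuclideanSpace.proj i : EuclideanSpace ℝ ι →L[ℝ] ℝ).toLinearMap
  have hπ : ∀ x, π x = x i := fun x => rfl
  have hle : Submodule.span ℝ F ≤ Submodule.span ℝ Q ⊓ LinearMap.ker π := by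
    refine le_inf (Submodule.span_mono hsub) ?_
    rw [Submodule.span_le]
    exact fun x hx => hzmax i hzi x hx
  have hlt : Submodule.span ℝ Q ⊓ LinearMap.ker π < Submodule.span ℝ Q := by
    refine lt_of_le_of_ne inf_le_left fun heq => hqi ?_
    have : q ∈ Submodule.span ℝ Q ⊓ LinearMap.ker π := by
      rw [heq]
      exact Submodule.subset_span hq
    exact this.2
  have hfin := Submodule.finrank_lt_finrank_of_lt hlt
  -- The hyperplane section lies strictly below the span of `Q` and contains the span of `F`, whose
  -- rank is only one less.
  have heq := Submodule.eq_of_le_of_finrank_le hle (by omega)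
  intro y hy hyi
  rw [heq]
  exact ⟨hy, hyi⟩

/-- An orthant section that is a simplex with `0/1` vertices: each vertex has a coordinate that
vanishes at all other vertices. -/
theorem IsOrthantSection.exists_dual_coordinate {s : Finset (EuclideanSpace ℝ ι)}
    (hQ : IsOrthantSection h (convexHull ℝ (s : Set (EuclideanSpace ℝ ι))))
    (hs : LinearIndepOn ℝ id (s : Set (EuclideanSpace ℝ ι)))
    (h01 : ∀ x ∈ s, ∀ i, x i = 0 ∨ x i = 1) {v : EuclideanSpace ℝ ι} (hv : v ∈ s) :
    ∃ i, v i = 1 ∧ ∀ w ∈ s, w ≠ v → w i = 0 := by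
  classical
  have hsub : ∀ x ∈ s, x ∈ convexHull ℝ (s : Set (EuclideanSpace ℝ ι)) :=
    fun x hx => subset_convexHull ℝ _ hx
  by_contra! hcon
  -- Without a dual coordinate for `v`, this combination is nonnegative, so after rescaling it lies
  -- in the simplex despite its negative coefficient at `v`. The weight `2` rather than `1` keeps
  -- the height positive even with a single other vertex.
  let g : EuclideanSpace ℝ ι → ℝ := fun w => if w = v then -1 else 2
  let y : EuclideanSpace ℝ ι := ∑ w ∈ s, g w • w
  have hy : y = ∑ w ∈ s.erase v, (2 : ℝ) • w - v := by
    simp only [y]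
    rw [← Finset.sum_erase_add _ _ hv]
    have : ∀ w ∈ s.erase v, g w • w = (2 : ℝ) • w := fun w hw => by
      simp [g, Finset.ne_of_mem_erase hw]
    rw [Finset.sum_congr rfl this]
    simp [g, sub_eq_add_neg]
  have hyi : ∀ i, y i = ∑ w ∈ s.erase v, 2 * w i - v i := fun i => by
    rw [hy]
    simp [WithLp.ofLp_sum, Finset.sum_apply]
  have hy0 : ∀ i, 0 ≤ y i := by
    intro i
    rw [hyi]
    have hnn : ∀ w ∈ s.erase v, 0 ≤ 2 * w i := fun w hw =>
      mul_nonneg zero_le_two (hQ.nonneg w (hsub w (Finset.mem_of_mem_erase hw)) i)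
    rcases h01 v hv i with hi | hi
    · rw [hi, sub_zero]
      exact Finset.sum_nonneg hnn
    · obtain ⟨w, hw, hwv, hwi⟩ := hcon i hi
      have hw1 := (h01 w hw i).resolve_left hwi
      have := Finset.single_le_sum hnn (Finset.mem_erase.2 ⟨hwv, hw⟩)
      rw [hw1] at this
      rw [hi]
      linarith
  have hhy : h y = 2 * (s.erase v).card - 1 := by
    rw [hy, map_sub, map_sum, hQ.height v (hsub v hv), Finset.sum_congr rfl (g := fun _ => (2 : ℝ))]
    · simp [mul_comm]
    · intro w hw
      simp [hQ.height w (hsub w (Finset.mem_of_mem_erase hw))]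
  rcases (s.erase v).eq_empty_or_nonempty with he | he
  · have hv0 : v = 0 := by
      ext i
      have := hy0 i
      rw [hyi, he] at this
      have h2 := hQ.nonneg v (hsub v hv) i
      simp at this ⊢
      linarith
    have := hQ.height v (hsub v hv)
    simp [hv0] at this
  · have hpos : 0 < h y := by
      have : (1 : ℝ) ≤ (s.erase v).card := by exact_mod_cast he.card_pos
      rw [hhy]
      linarith
    have hmem : (h y)⁻¹ • y ∈ convexHull ℝ (s : Set (EuclideanSpace ℝ ι)) := by
      refine hQ.mem _ (Submodule.smul_mem _ _ (Submodule.sum_mem _ fun w hw =>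
        Submodule.smul_mem _ _ (Submodule.subset_span (hsub w hw)))) (fun i => ?_) ?_
      · exact mul_nonneg (inv_nonneg.2 hpos.le) (hy0 i)
      · simp [hpos.ne']
    rw [Finset.mem_convexHull'] at hmem
    obtain ⟨a, ha0, -, hay⟩ := hmem
    have hzero : ∑ w ∈ s, (a w - (h y)⁻¹ * g w) • w = 0 := by
      simp only [sub_smul, Finset.sum_sub_distrib, hay, mul_smul, ← Finset.smul_sum]
      exact sub_self _
    have := linearIndepOn_finset_iff.1 hs _ hzero v hv
    have hav := ha0 v hv
    have hinv := inv_pos.2 hpos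
    simp [g] at this
    linarith

end OrthantSections

/-! ### Faces and facets of a complex. -/

section Complexes

variable {V : Type*}

theorem SubsetComplex.IsDecomposable.nonempty {Δ : SubsetComplex V}
    (hΔ : Δ.IsDecomposable) : ∃ F, F ∈ Δ := by
  induction hΔ with
  | simplex S => exact ⟨S, LowerSet.mem_Iic_iff.2 le_rfl⟩
  | glue Δ Δ₁ S Δ₂ h h₁ h₂ ih₁ ih₂ =>
    obtain ⟨F, hF⟩ := ih₁
    exact ⟨F, h.union_eq ▸ LowerSet.mem_sup_iff.2 (Or.inl hF)⟩

theorem SubsetComplex.exists_facet_superset [Fintype V] {Δ : SubsetComplex V} {F : Finset V}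
    (hF : F ∈ Δ) :
    ∃ S ∈ Δ.facets, F ⊆ S := by
  obtain ⟨S, hFS, hS⟩ := (Set.toFinite {T | T ∈ Δ}).exists_le_maximal hF
  exact ⟨S, by simpa [SubsetComplex.facets] using hS, hFS⟩

theorem SubsetComplex.mem_of_mem_facets [Fintype V] {Δ : SubsetComplex V} {S : Finset V}
    (hS : S ∈ Δ.facets) : S ∈ Δ := by
  simp only [SubsetComplex.facets, Finset.mem_filter] at hS
  exact hS.2.prop

end Complexes

/-! ### Margins of tables and gluing along a decomposition. -/

section Margins

variable {V : Type*} [Fintype V] [DecidableEq V] {d : V → ℕ}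

/-- The `F`-margin of the table `u`, as a function of the full index `t`. -/
def tableMargin (u : ((v : V) → Fin (d v)) → ℝ) (F : Finset V) (t : (v : V) → Fin (d v)) : ℝ :=
  ∑ s with ∀ v ∈ F, s v = t v, u s

/-- The number of cells contributing to an entry of the `F`-margin. -/
def marginFiberCard (F : Finset V) (t : (v : V) → Fin (d v)) : ℕ :=
  Finset.card {s : (v : V) → Fin (d v) | ∀ v ∈ F, s v = t v}

theorem marginFiberCard_pos (F : Finset V) (t : (v : V) → Fin (d v)) :
    0 < marginFiberCard F t :=
  Finset.card_pos.2 ⟨t, by simp⟩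

theorem tableMargin_congr (u : ((v : V) → Fin (d v)) → ℝ) {F : Finset V}
    {s t : (v : V) → Fin (d v)} (h : ∀ v ∈ F, s v = t v) :
    tableMargin u F s = tableMargin u F t := by
  unfold tableMargin
  congr 1
  ext x
  simp only [Finset.mem_filter, Finset.mem_univ, true_and]
  exact forall₂_congr fun v hv => by rw [h v hv]

theorem marginFiberCard_congr {F : Finset V} {s t : (v : V) → Fin (d v)}
    (h : ∀ v ∈ F, s v = t v) : marginFiberCard F s = marginFiberCard F t := by
  unfold marginFiberCard
  congr 1
  ext x
  simp only [Finset.mem_filter, Finset.mem_univ, true_and]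
  exact forall₂_congr fun v hv => by rw [h v hv]

theorem tableMargin_nonneg {u : ((v : V) → Fin (d v)) → ℝ} (hu : ∀ t, 0 ≤ u t) (F : Finset V)
    (t : (v : V) → Fin (d v)) : 0 ≤ tableMargin u F t :=
  Finset.sum_nonneg fun s _ => hu s

/-- Spreading the `G`-margin uniformly over its fibers preserves the margins along subsets
of `G`. -/
theorem tableMargin_spread (u : ((v : V) → Fin (d v)) → ℝ) {F G : Finset V} (hFG : F ⊆ G)
    (t : (v : V) → Fin (d v)) :
    tableMargin (fun s => tableMargin u G s / marginFiberCard G s) F t = tableMargin u F t := by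
  calc tableMargin (fun s => tableMargin u G s / marginFiberCard G s) F t
      = ∑ s : (v : V) → Fin (d v) with ∀ v ∈ F, s v = t v,
          ∑ x : (v : V) → Fin (d v) with ∀ v ∈ G, x v = s v, u x / marginFiberCard G x := by
        rw [tableMargin]
        refine Finset.sum_congr rfl fun s _ => ?_
        rw [tableMargin, Finset.sum_div]
        refine Finset.sum_congr rfl fun x hx => ?_
        rw [marginFiberCard_congr (Finset.mem_filter.1 hx).2]
    _ = ∑ x : (v : V) → Fin (d v) with ∀ v ∈ F, x v = t v,
          ∑ s : (v : V) → Fin (d v) with ∀ v ∈ G, s v = x v, u x / marginFiberCard G x := by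
        refine Finset.sum_comm' fun s x => ?_
        simp only [Finset.mem_filter, Finset.mem_univ, true_and]
        constructor
        · rintro ⟨h, h'⟩
          exact ⟨fun v hv => (h' v hv).symm, fun v hv => (h' v (hFG hv)).trans (h v hv)⟩
        · rintro ⟨h, h'⟩
          exact ⟨fun v hv => (h v (hFG hv)).trans (h' v hv), fun v hv => (h v hv).symm⟩
    _ = tableMargin u F t := by
        refine Finset.sum_congr rfl fun x _ => ?_
        have : (marginFiberCard G x : ℝ) ≠ 0 := by exact_mod_cast (marginFiberCard_pos G x).ne'
        rw [Finset.sum_const, nsmul_eq_mul]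
        exact mul_div_cancel₀ _ this

/-- The spread table depends on `u` only through its `G`-margin and still has the right `F`-margin.
-/
theorem tableMargin_eq_of_subset {u u' : ((v : V) → Fin (d v)) → ℝ} {F G : Finset V}
    (hFG : F ⊆ G) (h : ∀ t, tableMargin u G t = tableMargin u' G t) (t : (v : V) → Fin (d v)) :
    tableMargin u F t = tableMargin u' F t := by
  rw [← tableMargin_spread u hFG, ← tableMargin_spread u' hFG]
  simp_rw [h]

theorem tableMargin_nonneg_of_subset {u : ((v : V) → Fin (d v)) → ℝ} {F G : Finset V}
    (hFG : F ⊆ G) (h : ∀ t, 0 ≤ tableMargin u G t) (t : (v : V) → Fin (d v)) :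
    0 ≤ tableMargin u F t := by
  rw [← tableMargin_spread u hFG]
  exact tableMargin_nonneg (fun s => div_nonneg (h s) (Nat.cast_nonneg _)) F t

theorem tableMargin_le_of_subset {u : ((v : V) → Fin (d v)) → ℝ} (hu : ∀ t, 0 ≤ u t)
    {F G : Finset V} (hFG : F ⊆ G) (t : (v : V) → Fin (d v)) :
    tableMargin u G t ≤ tableMargin u F t := by
  refine Finset.sum_le_sum_of_subset_of_nonneg (fun s hs => ?_) fun s _ _ => hu s
  simp only [Finset.mem_filter, Finset.mem_univ, true_and] at hs ⊢
  exact fun v hv => hs v (hFG hv)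

/-- If `G` and `H` cover all directions, summing the `H`-margin over a fiber of the restriction
to `G` gives the `G ∩ H`-margin. -/
theorem tableMargin_tableMargin (u : ((v : V) → Fin (d v)) → ℝ) {G H : Finset V}
    (hGH : G ∪ H = Finset.univ) (t : (v : V) → Fin (d v)) :
    tableMargin (tableMargin u H) G t = tableMargin u (G ∩ H) t := by
  have hcov : ∀ v, v ∉ G → v ∈ H := fun v hv => by
    have := Finset.mem_univ v
    rw [← hGH, Finset.mem_union] at this
    exact this.resolve_left hv
  calc tableMargin (tableMargin u H) G t
      = ∑ x : (v : V) → Fin (d v) with ∀ v ∈ G ∩ H, x v = t v,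
          ∑ s : (v : V) → Fin (d v) with (∀ v ∈ G, s v = t v) ∧ ∀ v ∈ H, x v = s v, u x := by
        unfold tableMargin
        refine Finset.sum_comm' fun s x => ?_
        simp only [Finset.mem_filter, Finset.mem_univ, true_and, Finset.mem_inter]
        constructor
        · rintro ⟨h, h'⟩
          exact ⟨⟨h, h'⟩, fun v hv => (h' v hv.2).trans (h v hv.1)⟩
        · rintro ⟨h, -⟩
          exact h
    _ = tableMargin u (G ∩ H) t := by
        refine Finset.sum_congr rfl fun x hx => ?_
        simp only [Finset.mem_filter, Finset.mem_univ, true_and, Finset.mem_inter] at hx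
        have : (Finset.univ.filter fun s : (v : V) → Fin (d v) =>
            (∀ v ∈ G, s v = t v) ∧ ∀ v ∈ H, x v = s v) =
            {fun v => if v ∈ G then t v else x v} := by
          ext s
          simp only [Finset.mem_filter, Finset.mem_univ, true_and, Finset.mem_singleton]
          constructor
          · rintro ⟨h, h'⟩
            funext v
            by_cases hv : v ∈ G
            · simp [hv, h v hv]
            · simp [hv, h' v (hcov v hv)]
          · rintro rfl
            refine ⟨fun v hv => by simp [hv], fun v hv => ?_⟩
            by_cases hv' : v ∈ G
            · simp [hv', hx v ⟨hv', hv⟩]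
            · simp [hv']
        rw [this, Finset.sum_singleton]

/-- The conditional-independence product of two nonnegative tables has the `G`-margin of the
first. -/
theorem tableMargin_glue {u₁ u₂ : ((v : V) → Fin (d v)) → ℝ} (hu₁ : ∀ t, 0 ≤ u₁ t)
    {G H : Finset V} (hGH : G ∪ H = Finset.univ)
    (h : ∀ t, tableMargin u₁ (G ∩ H) t = tableMargin u₂ (G ∩ H) t)
    (t : (v : V) → Fin (d v)) :
    tableMargin (fun s => tableMargin u₁ G s * tableMargin u₂ H s / tableMargin u₁ (G ∩ H) s) G t =
      tableMargin u₁ G t := by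
  -- On a fiber of the restriction to `G`, only the factor `tableMargin u₂ H` varies.
  have hfac : tableMargin
      (fun s => tableMargin u₁ G s * tableMargin u₂ H s / tableMargin u₁ (G ∩ H) s) G t =
      tableMargin u₁ G t / tableMargin u₁ (G ∩ H) t * tableMargin (tableMargin u₂ H) G t := by
    rw [tableMargin.eq_1 _ G t, tableMargin.eq_1 (tableMargin u₂ H) G t, Finset.mul_sum]
    refine Finset.sum_congr rfl fun s hs => ?_
    have hs' := (Finset.mem_filter.1 hs).2
    rw [tableMargin_congr u₁ hs',
      tableMargin_congr u₁ (F := G ∩ H) fun v hv => hs' v (Finset.mem_inter.1 hv).1]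
    ring
  rw [hfac, tableMargin_tableMargin u₂ hGH, ← h]
  -- Where the denominator vanishes the quotient is `0` by convention, and nonnegativity of `u₁`
  -- makes its `G`-margin vanish there too.
  by_cases h0 : tableMargin u₁ (G ∩ H) t = 0
  · have h1 := tableMargin_le_of_subset hu₁ (Finset.inter_subset_left : G ∩ H ⊆ G) t
    have h2 := tableMargin_nonneg hu₁ G t
    rw [h0] at h1 ⊢
    simp [le_antisymm h1 h2]
  · exact div_mul_cancel₀ _ h0

/-- For a decomposable complex, a table with nonnegative margins can be replaced by a nonnegative
table with the same margins. -/
theorem SubsetComplex.IsDecomposable.exists_nonneg_table {Δ : SubsetComplex V}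
    (hΔ : Δ.IsDecomposable) (u : ((v : V) → Fin (d v)) → ℝ)
    (hu : ∀ F ∈ Δ, ∀ t, 0 ≤ tableMargin u F t) :
    ∃ u' : ((v : V) → Fin (d v)) → ℝ, (∀ t, 0 ≤ u' t) ∧
      ∀ F ∈ Δ, ∀ t, tableMargin u' F t = tableMargin u F t := by
  induction hΔ with
  | simplex S =>
    refine ⟨fun s => tableMargin u S s / marginFiberCard S s, fun t => ?_, fun F hF t => ?_⟩
    · exact div_nonneg (hu S (LowerSet.mem_Iic_iff.2 le_rfl) t) (Nat.cast_nonneg _)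
    · exact tableMargin_spread u (LowerSet.mem_Iic_iff.1 hF) t
  | glue Δ Δ₁ S Δ₂ h h₁ h₂ ih₁ ih₂ =>
    have hle₁ : ∀ F ∈ Δ₁, F ∈ Δ := fun F hF => h.union_eq ▸ LowerSet.mem_sup_iff.2 (Or.inl hF)
    have hle₂ : ∀ F ∈ Δ₂, F ∈ Δ := fun F hF => h.union_eq ▸ LowerSet.mem_sup_iff.2 (Or.inr hF)
    have hS : S ∈ Δ₁ ∧ S ∈ Δ₂ := by
      rw [← LowerSet.mem_inf_iff, h.inter_eq]
      exact LowerSet.mem_Iic_iff.2 le_rfl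
    obtain ⟨u₁, hu₁, hm₁⟩ := ih₁ fun F hF => hu F (hle₁ F hF)
    obtain ⟨u₂, hu₂, hm₂⟩ := ih₂ fun F hF => hu F (hle₂ F hF)
    classical
    -- Elements of `V` that are vertices of neither part are put into `G`, so that `G` and `H` cover
    -- `V` and meet exactly in `S`.
    let H : Finset V := {v | {v} ∈ Δ₂}
    let G : Finset V := S ∪ Hᶜ
    have hH : ∀ F ∈ Δ₂, F ⊆ H := fun F hF v hv =>
      Finset.mem_filter.2 ⟨Finset.mem_univ v, Δ₂.lower (Finset.singleton_subset_iff.2 hv) hF⟩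
    have hG : ∀ F ∈ Δ₁, F ⊆ G := fun F hF v hv => by
      by_cases hvH : v ∈ H
      · have hv₁ : ({v} : Finset V) ∈ Δ₁ := Δ₁.lower (Finset.singleton_subset_iff.2 hv) hF
        have hv₂ : ({v} : Finset V) ∈ Δ₂ := (Finset.mem_filter.1 hvH).2
        have : ({v} : Finset V) ∈ Δ₁ ⊓ Δ₂ := LowerSet.mem_inf_iff.2 ⟨hv₁, hv₂⟩
        rw [h.inter_eq, LowerSet.mem_Iic_iff] at this
        exact Finset.mem_union_left _ (this (Finset.mem_singleton_self v))
      · exact Finset.mem_union_right _ (Finset.mem_compl.2 hvH)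
    have hGH : G ∪ H = Finset.univ := by
      ext v
      by_cases hv : v ∈ H <;> simp [G, hv]
    have hint : G ∩ H = S := by
      ext v
      have hv' : v ∈ S → v ∈ H := fun hv => hH S hS.2 hv
      by_cases hv : v ∈ H
      · simp [G, hv]
      · simp [hv, mt hv' hv]
    have hmS : ∀ t, tableMargin u₁ (G ∩ H) t = tableMargin u₂ (G ∩ H) t := fun t => by
      rw [hint, hm₁ S hS.1, hm₂ S hS.2]
    refine ⟨fun s => tableMargin u₁ G s * tableMargin u₂ H s / tableMargin u₁ (G ∩ H) s,
      fun t => div_nonneg (mul_nonneg (tableMargin_nonneg hu₁ _ _) (tableMargin_nonneg hu₂ _ _))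
        (tableMargin_nonneg hu₁ _ _), fun F hF t => ?_⟩
    rw [← h.union_eq, LowerSet.mem_sup_iff] at hF
    rcases hF with hF | hF
    · rw [← hm₁ F hF]
      exact tableMargin_eq_of_subset (hG F hF) (tableMargin_glue hu₁ hGH hmS) t
    · rw [← hm₂ F hF]
      refine tableMargin_eq_of_subset (hH F hF) (fun t => ?_) t
      have hHG : H ∪ G = Finset.univ := by rw [Finset.union_comm, hGH]
      rw [← tableMargin_glue hu₂ hHG (fun t => by rw [Finset.inter_comm, hmS]) t]
      simp_rw [hmS, Finset.inter_comm H G, mul_comm]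

/-- The coordinates of a combination of the columns of the marginal matrix are the entries of the
margins of the coefficient table. -/
theorem sum_smul_columnPoint_apply {Δ : SubsetComplex V} (u : ((v : V) → Fin (d v)) → ℝ)
    (S : {S : Finset V // S ∈ Δ.facets}) (t : (v : V) → Fin (d v)) :
    (∑ s, u s • columnPoint (marginalMatrix Δ d) s) ⟨S, fun v => t v.1⟩ = tableMargin u S.1 t := by
  rw [tableMargin, Finset.sum_filter]
  simp [columnPoint, marginalMatrix, WithLp.ofLp_sum, Finset.sum_apply, funext_iff]

theorem MarginCell.exists_eq (hd : ∀ v, 0 < d v) {Δ : SubsetComplex V} (r : MarginCell Δ d) :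
    ∃ t : (v : V) → Fin (d v), r = ⟨r.1, fun v => t v.1⟩ := by
  obtain ⟨S, c⟩ := r
  refine ⟨fun v => if hv : v ∈ S.1 then c ⟨v, hv⟩ else ⟨0, hd v⟩, ?_⟩
  congr 1
  funext v
  simp [v.2]

/-- The nonnegative vectors in the span of the columns are nonnegative combinations of the
columns. -/
theorem SubsetComplex.IsDecomposable.exists_nonneg_combination {Δ : SubsetComplex V}
    (hΔ : Δ.IsDecomposable) (hd : ∀ v, 0 < d v) {y : EuclideanSpace ℝ (MarginCell Δ d)}
    (hy : y ∈ Submodule.span ℝ (Set.range (columnPoint (marginalMatrix Δ d))))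
    (hy0 : ∀ r, 0 ≤ y r) :
    ∃ a : ((v : V) → Fin (d v)) → ℝ, (∀ t, 0 ≤ a t) ∧
      ∑ t, a t • columnPoint (marginalMatrix Δ d) t = y := by
  obtain ⟨u, rfl⟩ := (Submodule.mem_span_range_iff_exists_fun ℝ).1 hy
  obtain ⟨a, ha, ham⟩ := hΔ.exists_nonneg_table u fun F hF t => by
    obtain ⟨S, hS, hFS⟩ := SubsetComplex.exists_facet_superset hF
    refine tableMargin_nonneg_of_subset hFS (fun t => ?_) t
    rw [← sum_smul_columnPoint_apply u ⟨S, hS⟩ t]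
    exact hy0 _
  refine ⟨a, ha, ?_⟩
  ext r
  obtain ⟨t, ht⟩ := MarginCell.exists_eq hd r
  rw [ht, sum_smul_columnPoint_apply, sum_smul_columnPoint_apply,
    ham _ (SubsetComplex.mem_of_mem_facets r.1.2)]

theorem sum_columnPoint_marginalMatrix (Δ : SubsetComplex V) (t : (v : V) → Fin (d v)) :
    ∑ r, columnPoint (marginalMatrix Δ d) t r = Δ.facets.card := by
  rw [Fintype.sum_sigma]
  simp [columnPoint, marginalMatrix]

end Margins

/-! ### Pulling triangulations of orthant sections with `0/1` vertices. -/

section Compressed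

theorem span_convexHull {E : Type*} [AddCommGroup E] [Module ℝ E] (s : Set E) :
    Submodule.span ℝ (convexHull ℝ s) = Submodule.span ℝ s := by
  apply le_antisymm _ (Submodule.span_mono (subset_convexHull ℝ s))
  rw [Submodule.span_le]
  exact convexHull_min Submodule.subset_span (Submodule.span ℝ s).convex

variable {ι : Type*}

/-- The subgroup of vectors with integral coordinates. -/
def integralVectors (ι : Type*) : AddSubgroup (EuclideanSpace ℝ ι) where
  carrier := {x | ∀ i, ∃ n : ℤ, x i = n}
  zero_mem' := fun i => ⟨0, by simp⟩
  add_mem' := fun {x y} hx hy i => by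
    obtain ⟨m, hm⟩ := hx i
    obtain ⟨n, hn⟩ := hy i
    exact ⟨m + n, by simp [hm, hn]⟩
  neg_mem' := fun {x} hx i => by
    obtain ⟨m, hm⟩ := hx i
    exact ⟨-m, by simp [hm]⟩

theorem eq_zero_or_one_of_mem_integralVectors {x : EuclideanSpace ℝ ι}
    (hx : x ∈ integralVectors ι) {i : ι} (h0 : 0 ≤ x i) (h1 : x i ≤ 1) : x i = 0 ∨ x i = 1 := by
  obtain ⟨n, hn⟩ := hx i
  rw [hn] at h0 h1 ⊢
  have h0' : 0 ≤ n := Int.cast_nonneg_iff.1 h0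
  have h1' : n ≤ 1 := by
    rw [← Int.cast_one] at h1
    exact Int.cast_le.1 h1
  have : n = 0 ∨ n = 1 := by omega
  rcases this with rfl | rfl <;> simp

variable [Fintype ι] {h : EuclideanSpace ℝ ι →ₗ[ℝ] ℝ} {L : AddSubgroup (EuclideanSpace ℝ ι)}

/-- The simplices of a pulling triangulation of an orthant section with `0/1` vertices generate all
integral vectors of its linear span. -/
theorem IsPullingSimplex.generates {Q σ : Set (EuclideanSpace ℝ ι)}
    {l : List (EuclideanSpace ℝ ι)} (hσ : IsPullingSimplex Q l σ) (hL : L ≤ integralVectors ι)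
    (hQ : IsOrthantSection h Q) (hne : Q.Nonempty) (hQ1 : ∀ x ∈ Q, ∀ i, x i ≤ 1)
    (hconv : convexHull ℝ (latticePoints L Q) = Q) (hl : ∀ x, x ∈ l ↔ x ∈ latticePoints L Q) :
    σ ⊆ latticePoints L Q ∧ σ.ncard = Module.finrank ℝ (Submodule.span ℝ Q) ∧
      ∀ y ∈ Submodule.span ℝ Q, y ∈ integralVectors ι → y ∈ AddSubgroup.closure σ := by
  classical
  induction hσ with
  | base Q l hind =>
    have hset : {x | x ∈ l} = latticePoints L Q := Set.ext hl
    have hcoe : (l.toFinset : Set (EuclideanSpace ℝ ι)) = {x | x ∈ l} := by ext; simp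
    have hQl : convexHull ℝ (l.toFinset : Set (EuclideanSpace ℝ ι)) = Q := by
      rw [hcoe, hset, hconv]
    have hli : LinearIndepOn ℝ id (l.toFinset : Set (EuclideanSpace ℝ ι)) := by
      rw [hcoe]
      exact hind.linearIndependent_of_map_eq_one h fun x => hQ.height _ ((hl x.1).1 x.2).2
    have h01 : ∀ x ∈ l.toFinset, ∀ i, x i = 0 ∨ x i = 1 := fun x hx i => by
      have hx' := (hl x).1 (List.mem_toFinset.1 hx)
      exact eq_zero_or_one_of_mem_integralVectors (hL hx'.1) (hQ.nonneg x hx'.2 i)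
        (hQ1 x hx'.2 i)
    have hspan : Submodule.span ℝ Q = Submodule.span ℝ (l.toFinset : Set (EuclideanSpace ℝ ι)) := by
      rw [← hQl, span_convexHull]
    refine ⟨hset.le, ?_, fun y hy hyint => ?_⟩
    · rw [hspan, ← hcoe, Set.ncard_coe_finset, finrank_span_set_eq_card hli, Finset.toFinset_coe]
    · rw [hspan, Submodule.mem_span_finset] at hy
      obtain ⟨c, -, rfl⟩ := hy
      refine sum_mem fun v hv => ?_
      have hQ' : IsOrthantSection h (convexHull ℝ (l.toFinset : Set (EuclideanSpace ℝ ι))) := by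
        rwa [hQl]
      -- The coefficient of `v` is the `i`-th coordinate of the combination, hence an integer.
      obtain ⟨i, hvi, hwi⟩ := hQ'.exists_dual_coordinate hli h01 hv
      obtain ⟨n, hn⟩ := hyint i
      have hcv : c v = n := by
        rw [← hn]
        simp only [WithLp.ofLp_sum, Finset.sum_apply, PiLp.smul_apply, smul_eq_mul]
        rw [Finset.sum_eq_single_of_mem v hv fun w hw hwv => by rw [hwi w hw hwv, mul_zero], hvi,
          mul_one]
      rw [hcv, Int.cast_smul_eq_zsmul]
      have hvl : v ∈ {x | x ∈ l} := List.mem_toFinset.1 hv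
      exact zsmul_mem (AddSubgroup.subset_closure hvl) n
  | cone Q p l F σ hind hF hp hσ ih =>
    have hsub := hF.exposed.subset
    have hfin : (latticePoints L Q).Finite :=
      (p :: l).finite_toSet.subset fun x hx => (hl x).2 hx
    have hlat : latticePoints L F = latticePoints L Q ∩ F := by
      ext x
      exact ⟨fun hx => ⟨⟨hx.1, hsub hx.2⟩, hx.2⟩, fun hx => ⟨hx.1.1, hx.2⟩⟩
    have hQc : Convex ℝ Q := hconv ▸ convex_convexHull ℝ _
    have hFs := hQ.of_isExposed hF.exposed hF.nonempty
    obtain ⟨i, hFi, hspan⟩ := hQ.exists_coordinate hQc hF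
    obtain ⟨hσF, hcard, hgen⟩ := ih hFs hF.nonempty (fun x hx => hQ1 x (hsub hx))
      (by
        rw [hlat]
        exact IsExposed.convexHull_inter_eq hfin (by rw [hconv]; exact hF.exposed))
      (fun x => by rw [hlat, List.mem_filter, hl]; simp)
    have hpQ : p ∈ latticePoints L Q := (hl p).1 List.mem_cons_self
    -- If `p i` were `0`, then `p` would lie in the span of `F`, hence in `F`.
    have hpi : p i = 1 := by
      refine (eq_zero_or_one_of_mem_integralVectors (hL hpQ.1) (hQ.nonneg p hpQ.2 i)
        (hQ1 p hpQ.2 i)).resolve_left fun hpi => hp ?_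
      exact hFs.mem p (hspan p (Submodule.subset_span hpQ.2) hpi) (hQ.nonneg p hpQ.2)
        (hQ.height p hpQ.2)
    refine ⟨Set.insert_subset hpQ fun x hx => ⟨(hσF hx).1, hsub (hσF hx).2⟩, ?_,
      fun y hy hyint => ?_⟩
    · have hdim := hF.dim
      unfold polytopeDim at hdim
      rw [Set.ncard_insert_of_notMem (fun hpσ => hp (hσF hpσ).2)
        (hfin.subset fun x hx => ⟨(hσF hx).1, hsub (hσF hx).2⟩), hcard,
        finrank_span_eq_finrank_vectorSpan_add_one hne h hQ.height, ← hdim,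
        finrank_span_eq_finrank_vectorSpan_add_one hF.nonempty h hFs.height]
    · obtain ⟨n, hn⟩ := hyint i
      have hpc : p ∈ AddSubgroup.closure (insert p σ) :=
        AddSubgroup.subset_closure (Set.mem_insert p σ)
      -- Subtracting `n • p` clears coordinate `i`, so the difference falls into the span of `F`,
      -- where the induction hypothesis applies.
      have hdiff : y - n • p ∈ AddSubgroup.closure σ := by
        refine hgen _ (hspan _ ?_ ?_) (sub_mem hyint (zsmul_mem (hL hpQ.1) n))
        · exact sub_mem hy (zsmul_mem (Submodule.subset_span hpQ.2) n)
        · rw [← Int.cast_smul_eq_zsmul ℝ]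
          simp [hn, hpi]
      rw [← sub_add_cancel y (n • p)]
      exact add_mem (AddSubgroup.closure_mono (Set.subset_insert p σ) hdiff) (zsmul_mem hpc n)

/-- Rewriting around the vertex `s 0` isolates the total coefficient `m`, which equals `1` for
points at height one. -/
theorem exists_zsmul_sum_of_mem_closure {E : Type*} [AddCommGroup E] {k : ℕ}
    (s : Fin (k + 1) → E) {x : E} (hx : x ∈ AddSubgroup.closure (Set.range s)) :
    ∃ (m : ℤ) (n : Fin k → ℤ), x = m • s 0 + ∑ j, n j • (s j.succ - s 0) := by
  induction hx using AddSubgroup.closure_induction with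
  | mem x hx =>
    obtain ⟨i, rfl⟩ := hx
    refine Fin.cases ⟨1, 0, by simp⟩ (fun j => ⟨1, Pi.single j 1, ?_⟩) i
    rw [Finset.sum_eq_single j (fun b _ hb => by simp [hb]) (by simp)]
    simp
  | zero => exact ⟨0, 0, by simp⟩
  | add x y _ _ hx hy =>
    obtain ⟨m, n, rfl⟩ := hx
    obtain ⟨m', n', rfl⟩ := hy
    refine ⟨m + m', n + n', ?_⟩
    simp only [add_smul, Pi.add_apply, Finset.sum_add_distrib]
    abel
  | neg x _ hx =>
    obtain ⟨m, n, rfl⟩ := hx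
    refine ⟨-m, -n, ?_⟩
    simp only [neg_smul, Pi.neg_apply, Finset.sum_neg_distrib]
    abel

theorem Set.exists_fin_injective_range_eq {α : Type*} {s : Set α} {k : ℕ}
    (hs : s.ncard = k + 1) : ∃ f : Fin (k + 1) → α, Function.Injective f ∧ Set.range f = s := by
  have hfin : s.Finite := Set.finite_of_ncard_pos (by omega)
  have := hfin.to_subtype
  let e : Fin (k + 1) ≃ s := (Finite.equivFinOfCardEq hs).symm
  exact ⟨fun i => e i, Subtype.val_injective.comp e.injective, by
    rw [← Function.comp_def, Set.range_comp, e.surjective.range_eq]; simp⟩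

theorem range_eq_insert_range_add {E : Type*} [AddCommGroup E] {k : ℕ} (s : Fin (k + 1) → E) :
    Set.range s = insert (s 0) (Set.range fun j : Fin k => s 0 + (s j.succ - s 0)) := by
  rw [Fin.range_fin_succ]
  simp [Fin.tail_def]

/-- A simplex generating the lattice has minimal volume. -/
theorem simplexVolume_le {P σ τ : Set (EuclideanSpace ℝ ι)}
    (hP : ∀ x ∈ P, h x = 1) (hσ : IsLatticeSimplex L P σ) (hτ : IsLatticeSimplex L P τ)
    (hgen : τ ⊆ AddSubgroup.closure σ) : simplexVolume P σ ≤ simplexVolume P τ := by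
  obtain ⟨s, hsinj, rfl⟩ := Set.exists_fin_injective_range_eq hσ.card
  obtain ⟨t, htinj, rfl⟩ := Set.exists_fin_injective_range_eq hτ.card
  have hsP : ∀ i, s i ∈ P := fun i => (hσ.subset ⟨i, rfl⟩).2
  have htP : ∀ i, t i ∈ P := fun i => (hτ.subset ⟨i, rfl⟩).2
  have hdir : ∀ u : Fin (polytopeDim P + 1) → EuclideanSpace ℝ ι, Function.Injective u →
      AffineIndependent ℝ (Subtype.val : Set.range u → EuclideanSpace ℝ ι) →
      LinearIndependent ℝ fun j : Fin (polytopeDim P) => u j.succ - u 0 := by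
    intro u hu hind
    have hu' : AffineIndependent ℝ u :=
      hind.comp_embedding ⟨Set.rangeFactorization u, fun a b hab => hu (congrArg Subtype.val hab)⟩
    have := (affineIndependent_iff_linearIndependent_vsub ℝ u 0).1 hu'
    exact this.comp (fun j : Fin (polytopeDim P) => ⟨j.succ, Fin.succ_ne_zero j⟩)
      fun a b hab => Fin.succ_injective _ (congrArg Subtype.val hab)
  let W := vectorSpan ℝ P
  let c (u : Fin (polytopeDim P + 1) → EuclideanSpace ℝ ι) (hu : ∀ i, u i ∈ P) :
      Fin (polytopeDim P) → W := fun j => ⟨u j.succ - u 0, vsub_mem_vectorSpan ℝ (hu _) (hu 0)⟩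
  have hc : ∀ u hu, LinearIndependent ℝ (fun j : Fin (polytopeDim P) => u j.succ - u 0) →
      LinearIndependent ℝ (c u hu) := fun u hu hli =>
    LinearIndependent.of_comp W.subtype hli
  have hcs := hc s hsP (hdir s hsinj hσ.affineIndependent)
  have hct := hc t htP (hdir t htinj hτ.affineIndependent)
  let b : Module.Basis (Fin (polytopeDim P)) ℝ W :=
    basisOfLinearIndependentOfCardEqFinrank' _ hcs (Fintype.card_fin _)
  have hb : ∀ j, b j = c s hsP j := fun j =>
    congrFun (coe_basisOfLinearIndependentOfCardEqFinrank' _ _ _) j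
  have hint : ∀ i j, ∃ n : ℤ, b.repr (c t htP j) i = n := by
    intro i j
    have key : ∀ x ∈ P, x ∈ AddSubgroup.closure (Set.range s) →
        ∃ n : Fin (polytopeDim P) → ℤ, x = s 0 + ∑ j, n j • (s j.succ - s 0) := by
      intro x hxP hx
      obtain ⟨m, n, hx⟩ := exists_zsmul_sum_of_mem_closure s hx
      have hm : m = 1 := by
        have := congrArg h hx
        simp only [map_add, map_sum, map_zsmul, map_sub, hP _ (hsP _), hP x hxP] at this
        simp at this
        exact_mod_cast this.symm
      exact ⟨n, by rw [hx, hm, one_smul]⟩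
    obtain ⟨n₁, h₁⟩ := key _ (htP j.succ) (hgen ⟨_, rfl⟩)
    obtain ⟨n₀, h₀⟩ := key _ (htP 0) (hgen ⟨_, rfl⟩)
    refine ⟨n₁ i - n₀ i, ?_⟩
    -- The base point `s 0` cancels in the difference of two vertices of the second simplex.
    have hexp : c t htP j = ∑ a, ((n₁ a - n₀ a : ℤ) : ℝ) • b a := by
      apply Subtype.val_injective
      have hba : ∀ a, ((b a : W) : EuclideanSpace ℝ ι) = s a.succ - s 0 := fun a => by rw [hb]
      change t j.succ - t 0 = _
      simp only [Submodule.coe_sum, Submodule.coe_smul, hba]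
      simp only [Int.cast_smul_eq_zsmul]
      rw [h₁, h₀]
      simp only [sub_smul (n₁ _), Finset.sum_sub_distrib]
      abel
    rw [hexp, b.repr_sum_self]
  have := euclideanHausdorffMeasure_simplex_le W b (c t htP) hct hint (s 0) (t 0)
  simp only [hb, c] at this
  rw [simplexVolume, simplexVolume, range_eq_insert_range_add s, range_eq_insert_range_add t]
  exact this

/-- An orthant section that is a lattice polytope with `0/1` vertices is compressed. -/
theorem IsOrthantSection.isCompressed {P : Set (EuclideanSpace ℝ ι)} (hP : IsOrthantSection h P)
    (hL : L ≤ integralVectors ι) (hne : P.Nonempty) (hP1 : ∀ x ∈ P, ∀ i, x i ≤ 1)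
    (hconv : convexHull ℝ (latticePoints L P) = P) : IsCompressed L P := by
  have hfin : (latticePoints L P).Finite := by
    refine ((Set.Finite.pi' fun _ : ι => Set.toFinite ({0, 1} : Set ℝ)).preimage
      (WithLp.ofLp_injective 2).injOn).subset fun x hx i => ?_
    exact eq_zero_or_one_of_mem_integralVectors (hL hx.1) (hP.nonneg x hx.2 i) (hP1 x hx.2 i)
  refine ⟨⟨hfin, hconv⟩, fun l _ hl σ hσ => ?_⟩
  obtain ⟨hsub, hcard, hgen⟩ := IsPullingSimplex.generates hσ hL hP hne hP1 hconv hl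
  have hspan : Submodule.span ℝ σ = Submodule.span ℝ P := by
    apply le_antisymm (Submodule.span_mono fun x hx => (hsub hx).2)
    rw [← hconv, span_convexHull, Submodule.span_le]
    intro x hx
    have hle : AddSubgroup.closure σ ≤ (Submodule.span ℝ σ).toAddSubgroup := by
      rw [AddSubgroup.closure_le]
      exact Submodule.subset_span
    exact hle (hgen x (Submodule.subset_span hx.2) (hL hx.1))
  -- `σ` spans and has exactly as many points as the rank of the span, so it is even linearly
  -- independent.
  have hind : AffineIndependent ℝ (Subtype.val : σ → EuclideanSpace ℝ ι) := by
    apply LinearIndependent.affineIndependent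
    have : Fintype σ := (hfin.subset hsub).fintype
    rw [linearIndependent_iff_card_eq_finrank_span, Subtype.range_coe, Set.finrank, hspan, ← hcard,
      ← Nat.card_eq_fintype_card, Nat.card_coe_set_eq]
  have hσs : IsLatticeSimplex L P σ :=
    ⟨hsub, hind, by rw [hcard, finrank_span_eq_finrank_vectorSpan_add_one hne h hP.height,
      polytopeDim]⟩
  refine ⟨hσs, fun τ hτ => simplexVolume_le hP.height hσs hτ fun x hx => ?_⟩
  have hx' := hτ.subset hx
  exact hgen x (Submodule.subset_span hx'.2) (hL hx'.1)

end Compressed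

/-! ### The marginal polytope as an orthant section. -/

section MarginalPolytopes

variable {V : Type*} [Fintype V] [DecidableEq V]

/-- The sum of all coordinates, normalized to be `1` on the columns of the marginal matrix. -/
noncomputable def marginHeight (Δ : SubsetComplex V) (d : V → ℕ) :
    EuclideanSpace ℝ (MarginCell Δ d) →ₗ[ℝ] ℝ :=
  (Δ.facets.card : ℝ)⁻¹ •
    ∑ r, (EuclideanSpace.proj r : EuclideanSpace ℝ (MarginCell Δ d) →L[ℝ] ℝ).toLinearMap

/-- Each column has exactly one entry `1` per facet, and a decomposable complex has at least one
facet, so the normalization is legitimate. -/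
theorem marginHeight_columnPoint {Δ : SubsetComplex V} (hΔ : Δ.IsDecomposable) {d : V → ℕ}
    (t : (v : V) → Fin (d v)) :
    marginHeight Δ d (columnPoint (marginalMatrix Δ d) t) = 1 := by
  obtain ⟨F, hF⟩ := hΔ.nonempty
  obtain ⟨S, hS, -⟩ := SubsetComplex.exists_facet_superset hF
  have hne : (Δ.facets.card : ℝ) ≠ 0 := by
    exact_mod_cast (Finset.card_pos.2 ⟨S, hS⟩).ne'
  have : marginHeight Δ d (columnPoint (marginalMatrix Δ d) t) =
      (Δ.facets.card : ℝ)⁻¹ * ∑ r, columnPoint (marginalMatrix Δ d) t r := by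
    simp [marginHeight]
  rw [this, sum_columnPoint_marginalMatrix, inv_mul_cancel₀ hne]

/-- The marginal polytope of a decomposable complex is cut out of its affine span by the
nonnegativity of the coordinates. -/
theorem SubsetComplex.IsDecomposable.isOrthantSection {Δ : SubsetComplex V}
    (hΔ : Δ.IsDecomposable) {d : V → ℕ} (hd : ∀ v, 0 < d v) :
    IsOrthantSection (marginHeight Δ d) (columnPolytope (marginalMatrix Δ d)) := by
  refine ⟨?_, ?_, fun y hy hy0 hy1 => ?_⟩
  · suffices columnPolytope (marginalMatrix Δ d) ⊆ {x | ∀ i, 0 ≤ x i} from this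
    refine convexHull_min ?_ ?_
    · rintro _ ⟨t, rfl⟩ r
      simp only [columnPoint, marginalMatrix]
      split_ifs <;> simp
    · intro x hx y hy a b ha hb _ i
      exact add_nonneg (mul_nonneg ha (hx i)) (mul_nonneg hb (hy i))
  · suffices columnPolytope (marginalMatrix Δ d) ⊆ {x | marginHeight Δ d x = 1} from this
    refine convexHull_min ?_ (convex_hyperplane (marginHeight Δ d).isLinear 1)
    rintro _ ⟨t, rfl⟩
    exact marginHeight_columnPoint hΔ t
  · rw [columnPolytope, span_convexHull] at hy
    obtain ⟨a, ha, rfl⟩ := hΔ.exists_nonneg_combination hd hy hy0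
    rw [map_sum] at hy1
    simp only [map_smul, marginHeight_columnPoint hΔ, smul_eq_mul, mul_one] at hy1
    exact (convex_convexHull ℝ _).sum_mem (fun t _ => ha t) hy1
      fun t _ => subset_convexHull ℝ _ ⟨t, rfl⟩

end MarginalPolytopes

theorem mainTheorem6 {V : Type*} [Fintype V] [DecidableEq V] (Δ : SubsetComplex V)
    (hΔ : Δ.IsDecomposable) (d : V → ℕ) (hd : ∀ v, 0 < d v) :
    IsCompressed (columnLattice (marginalMatrix Δ d)) (columnPolytope (marginalMatrix Δ d)) := by
  have hcol : ∀ t, columnPoint (marginalMatrix Δ d) t ∈ columnPolytope (marginalMatrix Δ d) :=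
    fun t => subset_convexHull ℝ _ ⟨t, rfl⟩
  refine (hΔ.isOrthantSection hd).isCompressed ?_ ⟨_, hcol fun v => ⟨0, hd v⟩⟩ ?_ ?_
  · rw [columnLattice, AddSubgroup.closure_le]
    rintro _ ⟨t, rfl⟩ r
    exact ⟨marginalMatrix Δ d r t, rfl⟩
  · suffices columnPolytope (marginalMatrix Δ d) ⊆ {x | ∀ i, x i ≤ 1} from this
    refine convexHull_min ?_ ?_
    · rintro _ ⟨t, rfl⟩ r
      simp only [columnPoint, marginalMatrix]
      split_ifs <;> simp
    · intro x hx y hy a b ha hb hab i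
      calc a * x i + b * y i ≤ a * 1 + b * 1 := by
            gcongr
            exacts [hx i, hy i]
        _ = 1 := by rw [mul_one, mul_one, hab]
  · apply subset_antisymm
    · exact convexHull_min (fun x hx => hx.2) (convex_convexHull ℝ _)
    · refine convexHull_mono ?_
      rintro _ ⟨t, rfl⟩
      exact ⟨AddSubgroup.subset_closure ⟨t, rfl⟩, hcol t⟩
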